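/- Let $n,p,m\ge 0$ be integers, let $A\in\mathbb{R}^{n\times n}$, $B\in\mathbb{R}^{n\times p}$, $C\in\mathbb{R}^{m\times n}$, let $T>0$, and let $P_0\in\mathbb{R}^{n\times n}$ be symmetric and non-negative (positive semidefinite). For $\tau\in[0,T]$, $\xi\in\mathbb{R}^n$ and $u\in L^2((\tau,T);\mathbb{R}^p)$ let $x$ be the solution on $[\tau,T]$ of $x'=Ax+Bu$, $x(\tau)=\xi$, that is, the continuous function with $x(t)=\xi+\int_\tau^t\big(Ax(s)+Bu(s)\big)\,ds$ for all $t\in[\tau,T]$, and set $$J_{\tau,T}(x,u)=\int_\tau^T\big(\|Cx(s)\|^2+\|u(s)\|^2\big)\,ds+\langle P_0x(T),x(T)\rangle .$$ Then for every $\tau\in[0,T]$ there is exactly one symmetric matrix $P_T(\tau)\in\mathbb{R}^{n\times n}$ such that $$\langle P_T(\tau)\xi,\xi\rangle=\inf_{u\in L^2((\tau,T);\mathbb{R}^p)}J_{\tau,T}(x,u)\qquad\text{for all }\xi\in\mathbb{R}^n,$$ and the function $P_T$ so defined is differentiable on $[0,T]$ (one-sidedly at the end points) and satisfies $$P_T'+P_TA+A^\top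 P_T-P_TBB^\top P_T+C^\top C=0\quad\text{in }[0,T],\qquad P_T(T)=P_0 .$$ -/

import Mathlib

open MeasureTheory Set

/-- `x` is the solution on `[τ, T]` of `x' = A x + B u`, `x(τ) = ξ`: it is continuous there and
satisfies the integrated equation. -/
def IsLQTrajectory {n p : ℕ} (A : Matrix (Fin n) (Fin n) ℝ) (B : Matrix (Fin n) (Fin p) ℝ)
    (τ T : ℝ) (ξ : EuclideanSpace ℝ (Fin n))
    (u : ℝ → EuclideanSpace ℝ (Fin p)) (x : ℝ → EuclideanSpace ℝ (Fin n)) : Prop :=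
  ContinuousOn x (Icc τ T) ∧
    ∀ t ∈ Icc τ T,
      x t = ξ + ∫ s in τ..t, (Matrix.toEuclideanLin A (x s) + Matrix.toEuclideanLin B (u s))

/-- The cost `J_{τ,T}(x, u) = ∫_τ^T (‖C x‖² + ‖u‖²) ds + ⟨P₀ x(T), x(T)⟩`. -/
noncomputable def lqCost {n p m : ℕ} (C : Matrix (Fin m) (Fin n) ℝ)
    (P₀ : Matrix (Fin n) (Fin n) ℝ) (τ T : ℝ)
    (x : ℝ → EuclideanSpace ℝ (Fin n)) (u : ℝ → EuclideanSpace ℝ (Fin p)) : ℝ :=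
  (∫ s in τ..T, (‖Matrix.toEuclideanLin C (x s)‖ ^ 2 + ‖u s‖ ^ 2)) +
    inner ℝ (Matrix.toEuclideanLin P₀ (x T)) (x T)

/-- All costs `J_{τ,T}(x, u)`, for `u ∈ L²((τ, T); ℝᵖ)` and `x` the solution of
`x' = A x + B u`, `x(τ) = ξ`. For `τ = T` the only cost is `⟨P₀ ξ, ξ⟩`. -/
def lqCosts {n p m : ℕ} (A : Matrix (Fin n) (Fin n) ℝ) (B : Matrix (Fin n) (Fin p) ℝ)
    (C : Matrix (Fin m) (Fin n) ℝ) (P₀ : Matrix (Fin n) (Fin n) ℝ) (τ T : ℝ)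
    (ξ : EuclideanSpace ℝ (Fin n)) : Set ℝ :=
  {c | ∃ (u : ℝ → EuclideanSpace ℝ (Fin p)) (x : ℝ → EuclideanSpace ℝ (Fin n)),
    MemLp u 2 (volume.restrict (Ioo τ T)) ∧ IsLQTrajectory A B τ T ξ u x ∧
      c = lqCost C P₀ τ T x u}

/-- `Q` is the value matrix at time `τ` of the linear quadratic problem with horizon `T`: it is
symmetric, and `⟨Q ξ, ξ⟩` is the infimum of the costs from `ξ` at time `τ`, for every `ξ`. -/
def IsLQValueMatrix {n p m : ℕ} (A : Matrix (Fin n) (Fin n) ℝ) (B : Matrix (Fin n) (Fin p) ℝ)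
    (C : Matrix (Fin m) (Fin n) ℝ) (P₀ : Matrix (Fin n) (Fin n) ℝ) (τ T : ℝ)
    (Q : Matrix (Fin n) (Fin n) ℝ) : Prop :=
  Q.IsSymm ∧ ∀ ξ : EuclideanSpace ℝ (Fin n),
    IsGLB (lqCosts A B C P₀ τ T ξ) (inner ℝ (Matrix.toEuclideanLin Q ξ) ξ)

/-! The value matrix is read off the Hamiltonian system `X' = A X - B Bᵀ Y`,
`Y' = -Cᵀ C X - Aᵀ Y` with `X(T) = 1`, `Y(T) = P₀`. For a fixed vector `v` the function
`⟨X v, Y v⟩` is nonincreasing and nonnegative at `T`, so `X(t) v = 0` forces it to be constant on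
`[t, T]`; then `Bᵀ Y v = 0` there, so `X v` solves `x' = A x` and `v = X(T) v = 0`. Hence `X` is
invertible on `(-∞, T]`, and `P = Y X⁻¹` is symmetric and solves the Riccati equation. Along any
trajectory, completing the square in the derivative of `⟨P x, x⟩` gives
`J(x, u) = ⟨P(τ) ξ, ξ⟩ + ∫ ‖u + Bᵀ P x‖²`, and the square vanishes for the feedback
`u = -Bᵀ P x`, whose trajectory is `X(t) X(τ)⁻¹ ξ`. -/

section AbsolutelyContinuous

open Filter

variable {E F : Type*} {a b : ℝ}

theorem absolutelyContinuousOnInterval_of_dist_le [PseudoMetricSpace E] [PseudoMetricSpace F]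
    {f : ℝ → E} {g : ℝ → F} (K : ℝ) (hf : AbsolutelyContinuousOnInterval f a b)
    (hgf : ∀ s ∈ uIcc a b, ∀ t ∈ uIcc a b, dist (g s) (g t) ≤ K * dist (f s) (f t)) :
    AbsolutelyContinuousOnInterval g a b := by
  have hK := Tendsto.const_mul K hf
  rw [mul_zero] at hK
  refine squeeze_zero' (Eventually.of_forall fun I => Finset.sum_nonneg fun i _ => dist_nonneg)
    ?_ hK
  filter_upwards [mem_inf_of_right (mem_principal_self _)] with I hI
  rw [Finset.mul_sum]
  exact Finset.sum_le_sum fun i hi => hgf _ (hI.1 i hi).1 _ (hI.1 i hi).2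

variable [NormedAddCommGroup E] [NormedAddCommGroup F]

theorem absolutelyContinuousOnInterval_prodMk {f : ℝ → E} {g : ℝ → F}
    (hf : AbsolutelyContinuousOnInterval f a b) (hg : AbsolutelyContinuousOnInterval g a b) :
    AbsolutelyContinuousOnInterval (fun t => (f t, g t)) a b := by
  have hinl : AbsolutelyContinuousOnInterval (fun t => (f t, (0 : F))) a b :=
    absolutelyContinuousOnInterval_of_dist_le 1 hf fun s _ t _ => by simp
  have hinr : AbsolutelyContinuousOnInterval (fun t => ((0 : E), g t)) a b :=
    absolutelyContinuousOnInterval_of_dist_le 1 hg fun s _ t _ => by simp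
  simpa using hinl.fun_add hinr

variable [NormedSpace ℝ E] [NormedSpace ℝ F]

theorem absolutelyContinuousOnInterval_contDiff_comp {φ : E → F} {f : ℝ → E}
    (hφ : ContDiff ℝ 1 φ) (hf : AbsolutelyContinuousOnInterval f a b) :
    AbsolutelyContinuousOnInterval (fun t => φ (f t)) a b := by
  obtain ⟨K, hK⟩ := hφ.locallyLipschitz.locallyLipschitzOn.exists_lipschitzOnWith_of_compact
    (isCompact_uIcc.image_of_continuousOn hf.continuousOn)
  exact absolutelyContinuousOnInterval_of_dist_le K hf fun s hs t ht =>
    hK.dist_le_mul _ (mem_image_of_mem f hs) _ (mem_image_of_mem f ht)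

theorem absolutelyContinuousOnInterval_of_eqOn_primitive {f f' : ℝ → E}
    (hf' : IntervalIntegrable f' volume a b)
    (hf : ∀ t ∈ uIcc a b, f t = f a + ∫ s in a..t, f' s) :
    AbsolutelyContinuousOnInterval f a b := by
  refine absolutelyContinuousOnInterval_of_dist_le 1
    (hf'.norm.absolutelyContinuousOnInterval_intervalIntegral left_mem_uIcc) fun s hs t ht => ?_
  have hint : ∀ r ∈ uIcc a b, IntervalIntegrable f' volume a r := fun r hr =>
    hf'.mono_set (uIcc_subset_uIcc_left hr)
  rw [one_mul, dist_comm, dist_comm _ (∫ s in a..t, _), hf s hs, hf t ht, dist_add_left,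
    dist_eq_norm, Real.dist_eq,
    intervalIntegral.integral_interval_sub_left (hint t ht) (hint s hs),
    intervalIntegral.integral_interval_sub_left (hint t ht).norm (hint s hs).norm]
  exact intervalIntegral.norm_integral_le_abs_integral_norm

theorem absolutelyContinuousOnInterval_of_hasDerivWithinAt [CompleteSpace E] {f f' : ℝ → E}
    (hab : a ≤ b) (hf : ∀ t ∈ Icc a b, HasDerivWithinAt f (f' t) (Icc a b) t)
    (hf' : ContinuousOn f' (Icc a b)) : AbsolutelyContinuousOnInterval f a b := by
  rw [← uIcc_of_le hab] at hf'
  refine absolutelyContinuousOnInterval_of_eqOn_primitive hf'.intervalIntegrable fun t ht => ?_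
  have hint := (hf'.mono (uIcc_subset_uIcc_left ht)).intervalIntegrable (μ := volume)
  rw [uIcc_of_le hab] at ht
  have hsub : Icc a t ⊆ Icc a b := Icc_subset_Icc_right ht.2
  rw [intervalIntegral.integral_eq_sub_of_hasDerivAt_of_le ht.1
    (fun s hs => ((hf s (hsub hs)).continuousWithinAt).mono hsub)
    (fun s hs => (hf s (hsub (Ioo_subset_Icc_self hs))).hasDerivAt
      (Icc_mem_nhds hs.1 (hs.2.trans_le ht.2))) hint, add_sub_cancel]

theorem integral_eq_sub_of_absolutelyContinuousOnInterval {f f' : ℝ → ℝ}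
    (hab : a ≤ b) (hf : AbsolutelyContinuousOnInterval f a b)
    (hderiv : ∀ᵐ t, t ∈ Ioo a b → HasDerivAt f (f' t) t) :
    ∫ t in a..b, f' t = f b - f a := by
  rw [← hf.integral_deriv_eq_sub, intervalIntegral.integral_of_le hab,
    intervalIntegral.integral_of_le hab, integral_Ioc_eq_integral_Ioo,
    integral_Ioc_eq_integral_Ioo]
  refine setIntegral_congr_ae measurableSet_Ioo ?_
  filter_upwards [hderiv] with t ht hmem using (ht hmem).deriv.symm

theorem ae_hasDerivAt_of_eqOn_primitive [CompleteSpace E] {f f' : ℝ → E} (hab : a ≤ b)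
    (hf' : IntervalIntegrable f' volume a b)
    (hf : ∀ t ∈ Icc a b, f t = f a + ∫ s in a..t, f' s) :
    ∀ᵐ t, t ∈ Ioo a b → HasDerivAt f (f' t) t := by
  filter_upwards [hf'.ae_hasDerivAt_integral] with t ht hmem
  rw [uIcc_of_le hab] at ht
  have hprim := (ht (Ioo_subset_Icc_self hmem) a (left_mem_Icc.2 hab)).const_add (f a)
  refine hprim.congr_of_eventuallyEq ?_
  filter_upwards [Ioo_mem_nhds hmem.1 hmem.2] with s hs using hf s (Ioo_subset_Icc_self hs)

end AbsolutelyContinuous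

theorem memLp_restrict_Ioo_of_continuousOn {E : Type*} [NormedAddCommGroup E]
    {f : ℝ → E} {a b : ℝ} (hf : ContinuousOn f (Icc a b)) (q : ENNReal) :
    MemLp f q (volume.restrict (Ioo a b)) := by
  obtain ⟨K, hK⟩ := isCompact_Icc.exists_bound_of_continuousOn hf
  have hmeas := (hf.mono Ioo_subset_Icc_self).aestronglyMeasurable (μ := volume) measurableSet_Ioo
  refine MemLp.of_bound hmeas K ?_
  filter_upwards [ae_restrict_mem measurableSet_Ioo] with t ht using hK t (Ioo_subset_Icc_self ht)

theorem intervalIntegrable_of_memLp_restrict_Ioo {E : Type*} [NormedAddCommGroup E] {f : ℝ → E}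
    {a b : ℝ} {q : ENNReal} (hab : a ≤ b) (hq : 1 ≤ q)
    (hf : MemLp f q (volume.restrict (Ioo a b))) :
    IntervalIntegrable f volume a b :=
  (intervalIntegrable_iff_integrableOn_Ioo_of_le hab).2 (hf.integrable hq)

theorem intervalIntegrable_norm_sq {E : Type*} [NormedAddCommGroup E] {f : ℝ → E} {a b : ℝ}
    (hab : a ≤ b) (hf : MemLp f 2 (volume.restrict (Ioo a b))) :
    IntervalIntegrable (fun t => ‖f t‖ ^ 2) volume a b :=
  (intervalIntegrable_iff_integrableOn_Ioo_of_le hab).2 (hf.integrable_norm_pow two_ne_zero)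

section Matrix

open scoped Matrix
open Matrix (toEuclideanLin)

variable {m n : Type*} [Fintype n] [DecidableEq n]

theorem inner_toEuclideanLin_left [Fintype m] [DecidableEq m] (M : Matrix m n ℝ)
    (v : EuclideanSpace ℝ n) (w : EuclideanSpace ℝ m) :
    inner ℝ (toEuclideanLin M v) w = inner ℝ v (toEuclideanLin Mᵀ w) := by
  rw [← Matrix.conjTranspose_eq_transpose_of_trivial,
    Matrix.toEuclideanLin_conjTranspose_eq_adjoint, LinearMap.adjoint_inner_right]

theorem isSymmetric_toEuclideanLin {Q : Matrix n n ℝ} (hQ : Q.IsSymm) :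
    (toEuclideanLin Q).IsSymmetric := fun v w => by
  rw [inner_toEuclideanLin_left, hQ.eq]

theorem toEuclideanLin_mul_apply {l : Type*} [Fintype l] [DecidableEq l] (M : Matrix m n ℝ)
    (N : Matrix n l ℝ) (v : EuclideanSpace ℝ l) :
    toEuclideanLin (M * N) v = toEuclideanLin M (toEuclideanLin N v) := by
  rw [Matrix.toLpLin_mul_same, LinearMap.comp_apply]

theorem eq_of_isSymm_of_inner_toEuclideanLin_eq {Q R : Matrix n n ℝ} (hQ : Q.IsSymm)
    (hR : R.IsSymm)
    (h : ∀ v, inner ℝ (toEuclideanLin Q v) v = inner ℝ (toEuclideanLin R v) v) : Q = R := by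
  refine sub_eq_zero.1 (toEuclideanLin.map_eq_zero_iff.1
    ((isSymmetric_toEuclideanLin (hQ.sub hR)).inner_map_self_eq_zero.1 fun v => ?_))
  rw [map_sub, LinearMap.sub_apply, inner_sub_left, h, sub_self]

theorem isSymm_mul_inv {R : Type*} [CommRing R] {X Y : Matrix n n R} (hX : IsUnit X)
    (h : (Xᵀ * Y).IsSymm) : (Y * X⁻¹).IsSymm := by
  have hcongr : Y * X⁻¹ = X⁻¹ᵀ * (Xᵀ * Y) * X⁻¹ := by
    rw [← Matrix.mul_assoc, ← Matrix.transpose_mul,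
      Matrix.mul_nonsing_inv X ((Matrix.isUnit_iff_isUnit_det X).1 hX), Matrix.transpose_one,
      Matrix.one_mul]
  rw [hcongr, Matrix.IsSymm, Matrix.transpose_mul, Matrix.transpose_mul, h.eq,
    Matrix.transpose_transpose, ← Matrix.mul_assoc]

open scoped Matrix.Norms.Operator

theorem hasDerivAt_transpose {m n : Type*} [Finite m] [Finite n] {M : ℝ → Matrix m n ℝ}
    {M' : Matrix m n ℝ} {t : ℝ} (hM : HasDerivAt M M' t) : HasDerivAt (fun s => (M s)ᵀ) M'ᵀ t := by
  cases nonempty_fintype m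
  cases nonempty_fintype n
  exact (LinearMap.toContinuousLinearMap
    (Matrix.transposeLinearEquiv m n ℝ ℝ).toLinearMap).hasFDerivAt.comp_hasDerivAt t hM

section Action

/-- The action of matrices on Euclidean vectors, `(M, v) ↦ M v`, as a continuous bilinear map, so
that the calculus of bounded bilinear maps applies to time-dependent matrices and vectors. -/
noncomputable def toEuclideanBilin (m n : Type*) [Fintype m] [Fintype n] [DecidableEq n] :
    Matrix m n ℝ →L[ℝ] EuclideanSpace ℝ n →L[ℝ] EuclideanSpace ℝ m :=
  LinearMap.toContinuousLinearMap
    (LinearMap.toContinuousLinearMap.toLinearMap ∘ₗ toEuclideanLin.toLinearMap)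

theorem continuousOn_toEuclideanLin_apply [Finite m] {M : ℝ → Matrix m n ℝ}
    {x : ℝ → EuclideanSpace ℝ n} {s : Set ℝ} (hM : ContinuousOn M s) (hx : ContinuousOn x s) :
    ContinuousOn (fun t => toEuclideanLin (M t) (x t)) s := by
  cases nonempty_fintype m
  exact ((toEuclideanBilin m n).continuous.comp_continuousOn hM).clm_apply hx

theorem hasDerivAt_toEuclideanLin_apply [Fintype m] {M : ℝ → Matrix m n ℝ} {M' : Matrix m n ℝ}
    {x : ℝ → EuclideanSpace ℝ n} {x' : EuclideanSpace ℝ n} {t : ℝ}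
    (hM : HasDerivAt M M' t) (hx : HasDerivAt x x' t) :
    HasDerivAt (fun s => toEuclideanLin (M s) (x s))
      (toEuclideanLin M' (x t) + toEuclideanLin (M t) x') t :=
  ((toEuclideanBilin m n).hasFDerivAt.comp_hasDerivAt t hM).clm_apply hx

theorem contDiff_inner_toEuclideanLin {k : WithTop ℕ∞} :
    ContDiff ℝ k fun z : Matrix n n ℝ × EuclideanSpace ℝ n =>
      inner ℝ (toEuclideanLin z.1 z.2) z.2 :=
  (toEuclideanBilin n n).isBoundedBilinearMap.contDiff.inner ℝ contDiff_snd

theorem absolutelyContinuousOnInterval_inner_toEuclideanLin {P : ℝ → Matrix n n ℝ}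
    {x : ℝ → EuclideanSpace ℝ n} {a b : ℝ} (hP : AbsolutelyContinuousOnInterval P a b)
    (hx : AbsolutelyContinuousOnInterval x a b) :
    AbsolutelyContinuousOnInterval (fun t => inner ℝ (toEuclideanLin (P t) (x t)) (x t)) a b :=
  absolutelyContinuousOnInterval_contDiff_comp (f := fun t => (P t, x t))
    (φ := fun z : Matrix n n ℝ × EuclideanSpace ℝ n => inner ℝ (toEuclideanLin z.1 z.2) z.2)
    contDiff_inner_toEuclideanLin (absolutelyContinuousOnInterval_prodMk hP hx)

end Action

theorem hasDerivAt_matrix_inv {M : ℝ → Matrix n n ℝ} {M' : Matrix n n ℝ} {t : ℝ}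
    (hM : HasDerivAt M M' t) (hunit : IsUnit (M t)) :
    HasDerivAt (fun s => (M s)⁻¹) (-((M t)⁻¹ * M' * (M t)⁻¹)) t := by
  obtain ⟨U, hU⟩ := hunit
  have hF := hasFDerivAt_ringInverse (𝕜 := ℝ) U
  rw [hU] at hF
  simp_rw [Matrix.nonsing_inv_eq_ringInverse, ← hU, Ring.inverse_unit]
  exact hF.comp_hasDerivAt t hM

end Matrix

section LinearODE

theorem exists_hasDerivAt_linear {E : Type*} [NormedAddCommGroup E] [NormedSpace ℝ E]
    [CompleteSpace E] (L : E →L[ℝ] E) (T : ℝ) (z : E) :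
    ∃ f : ℝ → E, f T = z ∧ ∀ t, HasDerivAt f (L (f t)) t := by
  refine ⟨fun t => NormedSpace.exp ((t - T) • L) z, by simp, fun t => ?_⟩
  have hexp := (hasDerivAt_exp_smul_const' (𝕂 := ℝ) L (t - T)).comp_sub_const t T
  simpa using hexp.clm_apply (hasDerivAt_const t z)

theorem eq_zero_of_hasDerivAt_linear {E : Type*} [NormedAddCommGroup E] [NormedSpace ℝ E]
    {f : ℝ → E} {a b : ℝ} (hab : a ≤ b) (L : E →L[ℝ] E)
    (hf : ∀ t ∈ Icc a b, HasDerivAt f (L (f t)) t) (ha : f a = 0) : f b = 0 := by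
  refine ODE_solution_unique (v := fun _ => L) (g := fun _ => 0) (fun _ => L.lipschitz)
    (fun t ht => (hf t ht).continuousAt.continuousWithinAt)
    (fun t ht => (hf t (Ico_subset_Icc_self ht)).hasDerivWithinAt) continuousOn_const
    (fun t _ => ?_) ha (right_mem_Icc.2 hab)
  simpa using hasDerivWithinAt_const t (Ici t) (0 : E)

theorem deriv_eq_zero_of_nonpos_of_le {f f' : ℝ → ℝ} {a b : ℝ} (hab : a < b)
    (hf : ∀ t ∈ Icc a b, HasDerivAt f (f' t) t) (hf' : ∀ t ∈ Icc a b, f' t ≤ 0)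
    (h : f a ≤ f b) : ∀ t ∈ Icc a b, f' t = 0 := by
  have hanti : AntitoneOn f (Icc a b) := antitoneOn_of_hasDerivWithinAt_nonpos (convex_Icc a b)
    (fun t ht => (hf t ht).continuousAt.continuousWithinAt)
    (fun t ht => (hf t (interior_subset ht)).hasDerivWithinAt)
    (fun t ht => hf' t (interior_subset ht))
  have hconst : ∀ t ∈ Icc a b, f t = f a := fun t ht =>
    le_antisymm (hanti (left_mem_Icc.2 hab.le) ht ht.1)
      (h.trans (hanti ht (right_mem_Icc.2 hab.le) ht.2))
  intro t ht
  exact (uniqueDiffOn_Icc hab t ht).eq_deriv _ (hf t ht).hasDerivWithinAt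
    ((hasDerivWithinAt_const t (Icc a b) (f a)).congr hconst (hconst t ht))

end LinearODE

open scoped Matrix
open Matrix (toEuclideanLin)

section Hamiltonian

variable {n p m : Type*} [Fintype n] [Fintype p] [Fintype m]
  {A : Matrix n n ℝ} {B : Matrix n p ℝ} {C : Matrix m n ℝ} {X Y : ℝ → Matrix n n ℝ}

/-- `(X, Y)` solves on `ℝ` the Hamiltonian system of the linear quadratic problem, with `X` for the
state and `Y` for the costate. The unknowns are matrices, so that all initial states are treated at
once: `(X v, Y v)` is a state-costate pair for every vector `v`. -/
structure IsHamiltonianSolution (A : Matrix n n ℝ) (B : Matrix n p ℝ) (C : Matrix m n ℝ)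
    (X Y : ℝ → Matrix n n ℝ) : Prop where
  hasDerivAt_state : ∀ t, HasDerivAt X (A * X t - B * Bᵀ * Y t) t
  hasDerivAt_costate : ∀ t, HasDerivAt Y (-(Cᵀ * C * X t) - Aᵀ * Y t) t

open scoped Matrix.Norms.Operator

theorem exists_isHamiltonianSolution (A : Matrix n n ℝ) (B : Matrix n p ℝ) (C : Matrix m n ℝ)
    (T : ℝ) (X₀ Y₀ : Matrix n n ℝ) :
    ∃ X Y : ℝ → Matrix n n ℝ, IsHamiltonianSolution A B C X Y ∧ X T = X₀ ∧ Y T = Y₀ := by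
  classical
  let H : Matrix n n ℝ × Matrix n n ℝ →L[ℝ] Matrix n n ℝ × Matrix n n ℝ :=
    LinearMap.toContinuousLinearMap
      { toFun := fun Z => (A * Z.1 - B * Bᵀ * Z.2, -(Cᵀ * C * Z.1) - Aᵀ * Z.2)
        map_add' := fun Z W => by
          ext1 <;> simp only [Prod.fst_add, Prod.snd_add, mul_add] <;> abel
        map_smul' := fun c Z => by ext1 <;> simp [smul_sub] }
  obtain ⟨f, hfT, hf⟩ := exists_hasDerivAt_linear H T (X₀, Y₀)
  refine ⟨fun t => (f t).1, fun t => (f t).2, ⟨fun t => ?_, fun t => ?_⟩, by simp [hfT],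
    by simp [hfT]⟩
  · exact hasFDerivAt_fst.comp_hasDerivAt t (hf t)
  · exact hasFDerivAt_snd.comp_hasDerivAt t (hf t)

namespace IsHamiltonianSolution

theorem isSymm_transpose_mul (h : IsHamiltonianSolution A B C X Y) {T : ℝ}
    (hT : ((X T)ᵀ * Y T).IsSymm) (t : ℝ) : ((X t)ᵀ * Y t).IsSymm := by
  classical
  have hderiv : ∀ s, HasDerivAt (fun s => (Y s)ᵀ * X s - (X s)ᵀ * Y s) 0 s := fun s => by
    have hX := h.hasDerivAt_state s
    have hY := h.hasDerivAt_costate s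
    refine (((hasDerivAt_transpose hY).mul hX).sub
      ((hasDerivAt_transpose hX).mul hY)).congr_deriv ?_
    simp only [Matrix.transpose_sub, Matrix.transpose_neg, Matrix.transpose_mul,
      Matrix.transpose_transpose]
    noncomm_ring
  have hconst := is_const_of_deriv_eq_zero (fun s => (hderiv s).differentiableAt)
    (fun s => (hderiv s).deriv) t T
  simp only [Matrix.IsSymm, Matrix.transpose_mul, Matrix.transpose_transpose] at hT ⊢
  rwa [hT, sub_self, sub_eq_zero] at hconst

variable [DecidableEq n]

theorem hasDerivAt_state_apply [DecidableEq p] (h : IsHamiltonianSolution A B C X Y)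
    (v : EuclideanSpace ℝ n) (t : ℝ) :
    HasDerivAt (fun s => toEuclideanLin (X s) v)
      (toEuclideanLin A (toEuclideanLin (X t) v) -
        toEuclideanLin B (toEuclideanLin Bᵀ (toEuclideanLin (Y t) v))) t := by
  simpa only [map_sub, LinearMap.sub_apply, toEuclideanLin_mul_apply, map_zero, add_zero] using
    hasDerivAt_toEuclideanLin_apply (h.hasDerivAt_state t) (hasDerivAt_const t v)

theorem hasDerivAt_costate_apply [DecidableEq m] (h : IsHamiltonianSolution A B C X Y)
    (v : EuclideanSpace ℝ n) (t : ℝ) :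
    HasDerivAt (fun s => toEuclideanLin (Y s) v)
      (-toEuclideanLin Cᵀ (toEuclideanLin C (toEuclideanLin (X t) v)) -
        toEuclideanLin Aᵀ (toEuclideanLin (Y t) v)) t := by
  simpa only [map_sub, map_neg, LinearMap.sub_apply, LinearMap.neg_apply,
    toEuclideanLin_mul_apply, map_zero, add_zero] using
    hasDerivAt_toEuclideanLin_apply (h.hasDerivAt_costate t) (hasDerivAt_const t v)

theorem hasDerivAt_inner (h : IsHamiltonianSolution A B C X Y) (v : EuclideanSpace ℝ n) (t : ℝ) :
    HasDerivAt (fun s => inner ℝ (toEuclideanLin (X s) v) (toEuclideanLin (Y s) v))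
      (-(‖toEuclideanLin Bᵀ (toEuclideanLin (Y t) v)‖ ^ 2 +
        ‖toEuclideanLin C (toEuclideanLin (X t) v)‖ ^ 2)) t := by
  classical
  refine ((h.hasDerivAt_state_apply v t).inner ℝ (h.hasDerivAt_costate_apply v t)).congr_deriv ?_
  rw [← real_inner_self_eq_norm_sq, ← real_inner_self_eq_norm_sq, inner_sub_right,
    inner_neg_right, inner_sub_left, inner_toEuclideanLin_left A, inner_toEuclideanLin_left B,
    ← inner_toEuclideanLin_left C]
  ring

theorem state_apply_eq_zero (h : IsHamiltonianSolution A B C X Y) {v : EuclideanSpace ℝ n}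
    {t T : ℝ} (htT : t ≤ T) (hv : toEuclideanLin (X t) v = 0)
    (hT : 0 ≤ inner ℝ (toEuclideanLin (X T) v) (toEuclideanLin (Y T) v)) :
    toEuclideanLin (X T) v = 0 := by
  classical
  rcases htT.eq_or_lt with rfl | hlt
  · exact hv
  have hBY : ∀ s ∈ Icc t T, toEuclideanLin Bᵀ (toEuclideanLin (Y s) v) = 0 := fun s hs => by
    have hzero := deriv_eq_zero_of_nonpos_of_le hlt (fun s _ => h.hasDerivAt_inner v s)
      (fun s _ => neg_nonpos.2 (by positivity)) (by simpa only [hv, inner_zero_left] using hT) s hs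
    rw [← norm_eq_zero, ← sq_eq_zero_iff]
    exact ((add_eq_zero_iff_of_nonneg (sq_nonneg _) (sq_nonneg _)).1 (neg_eq_zero.1 hzero)).1
  refine eq_zero_of_hasDerivAt_linear htT (LinearMap.toContinuousLinearMap (toEuclideanLin A))
    (f := fun s => toEuclideanLin (X s) v) (fun s hs => ?_) hv
  simpa only [hBY s hs, map_zero, sub_zero, LinearMap.coe_toContinuousLinearMap'] using
    h.hasDerivAt_state_apply v s

theorem isUnit_state (h : IsHamiltonianSolution A B C X Y) {t T : ℝ} (htT : t ≤ T)
    (hX : X T = 1) (hY : (Y T).PosSemidef) : IsUnit (X t) := by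
  refine Matrix.mulVec_injective_iff_isUnit.1
    ((injective_iff_map_eq_zero (X t).mulVecLin).2 fun v hv => ?_)
  rw [Matrix.mulVecLin_apply] at hv
  have hXT : toEuclideanLin (X T) (WithLp.toLp 2 v) = 0 := by
    refine h.state_apply_eq_zero htT (by simp [hv]) ?_
    rw [hX, Matrix.toLpLin_one, LinearMap.id_apply]
    exact (Matrix.isPositive_toEuclideanLin_iff.2 hY).inner_nonneg_right _
  rwa [hX, Matrix.toLpLin_one, LinearMap.id_apply, WithLp.toLp_eq_zero] at hXT

end IsHamiltonianSolution

end Hamiltonian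

section Riccati

variable {n p m : Type*} [Fintype n] [Fintype p] [Fintype m]
  {A : Matrix n n ℝ} {B : Matrix n p ℝ} {C : Matrix m n ℝ}

/-- The right-hand side of the Riccati equation, solved for the derivative: the equation
`P' + P A + Aᵀ P - P B Bᵀ P + Cᵀ C = 0` reads `P' = riccatiField A B C P`. -/
def riccatiField (A : Matrix n n ℝ) (B : Matrix n p ℝ) (C : Matrix m n ℝ) (P : Matrix n n ℝ) :
    Matrix n n ℝ :=
  -(P * A + Aᵀ * P - P * B * Bᵀ * P + Cᵀ * C)

theorem continuous_riccatiField : Continuous (riccatiField A B C) := by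
  unfold riccatiField
  fun_prop

section Derivative

open scoped Matrix.Norms.Operator

variable {P : ℝ → Matrix n n ℝ} {s : Set ℝ}

theorem differentiableOn_of_hasDerivWithinAt_riccatiField
    (hP : ∀ t ∈ s, HasDerivWithinAt P (riccatiField A B C (P t)) s t) : DifferentiableOn ℝ P s :=
  fun t ht => (hP t ht).differentiableWithinAt

theorem derivWithin_add_eq_zero_of_hasDerivWithinAt_riccatiField {t : ℝ}
    (hs : UniqueDiffWithinAt ℝ s t) (hP : HasDerivWithinAt P (riccatiField A B C (P t)) s t) :
    derivWithin P s t + P t * A + Aᵀ * P t - P t * B * Bᵀ * P t + Cᵀ * C = 0 := by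
  have hderiv : derivWithin P s t = riccatiField A B C (P t) := hP.derivWithin hs
  rw [hderiv, riccatiField]
  abel

end Derivative

variable [DecidableEq n]

theorem inner_riccatiField_add [DecidableEq p] {P : Matrix n n ℝ} (hP : P.IsSymm)
    (x : EuclideanSpace ℝ n) (u : EuclideanSpace ℝ p) :
    inner ℝ (toEuclideanLin (riccatiField A B C P) x) x +
        2 * inner ℝ (toEuclideanLin P x) (toEuclideanLin A x + toEuclideanLin B u) =
      ‖u + toEuclideanLin Bᵀ (toEuclideanLin P x)‖ ^ 2 - (‖toEuclideanLin C x‖ ^ 2 + ‖u‖ ^ 2) := by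
  classical
  have hPA : inner ℝ (toEuclideanLin P (toEuclideanLin A x)) x =
      inner ℝ (toEuclideanLin P x) (toEuclideanLin A x) := by
    rw [isSymmetric_toEuclideanLin hP, real_inner_comm]
  have hAP : inner ℝ (toEuclideanLin Aᵀ (toEuclideanLin P x)) x =
      inner ℝ (toEuclideanLin P x) (toEuclideanLin A x) := by
    rw [inner_toEuclideanLin_left, Matrix.transpose_transpose]
  have hPB : inner ℝ (toEuclideanLin P (toEuclideanLin B (toEuclideanLin Bᵀ
      (toEuclideanLin P x)))) x = ‖toEuclideanLin Bᵀ (toEuclideanLin P x)‖ ^ 2 := by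
    rw [isSymmetric_toEuclideanLin hP, inner_toEuclideanLin_left, real_inner_self_eq_norm_sq]
  have hC : inner ℝ (toEuclideanLin Cᵀ (toEuclideanLin C x)) x = ‖toEuclideanLin C x‖ ^ 2 := by
    rw [inner_toEuclideanLin_left, Matrix.transpose_transpose, real_inner_self_eq_norm_sq]
  have hBu : inner ℝ (toEuclideanLin P x) (toEuclideanLin B u) =
      inner ℝ u (toEuclideanLin Bᵀ (toEuclideanLin P x)) := by
    rw [real_inner_comm, inner_toEuclideanLin_left]
  simp only [riccatiField, map_neg, map_add, map_sub, LinearMap.neg_apply, LinearMap.add_apply,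
    LinearMap.sub_apply, toEuclideanLin_mul_apply, inner_neg_left, inner_add_left, inner_sub_left,
    inner_add_right, hPA, hAP, hPB, hC, hBu, norm_add_sq_real]
  ring

open scoped Matrix.Norms.Operator

theorem IsHamiltonianSolution.hasDerivAt_mul_inv {X Y : ℝ → Matrix n n ℝ}
    (h : IsHamiltonianSolution A B C X Y) {t : ℝ} (hunit : IsUnit (X t)) :
    HasDerivAt (fun s => Y s * (X s)⁻¹) (riccatiField A B C (Y t * (X t)⁻¹)) t := by
  refine ((h.hasDerivAt_costate t).mul
    (hasDerivAt_matrix_inv (h.hasDerivAt_state t) hunit)).congr_deriv ?_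
  have hXX : X t * (X t)⁻¹ = 1 :=
    Matrix.mul_nonsing_inv _ ((Matrix.isUnit_iff_isUnit_det _).1 hunit)
  have hY' : (-(Cᵀ * C * X t) - Aᵀ * Y t) * (X t)⁻¹ = -(Cᵀ * C) - Aᵀ * (Y t * (X t)⁻¹) := by
    rw [sub_mul, neg_mul, mul_assoc, hXX, mul_one, mul_assoc]
  have hX' : (X t)⁻¹ * (A * X t - B * Bᵀ * Y t) * (X t)⁻¹ =
      (X t)⁻¹ * A - (X t)⁻¹ * (B * Bᵀ) * (Y t * (X t)⁻¹) := by
    rw [mul_sub, sub_mul, ← mul_assoc, mul_assoc _ (X t), hXX, mul_one]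
    simp only [mul_assoc]
  rw [hY', hX', riccatiField]
  simp only [Matrix.mul_assoc, mul_sub, mul_neg]
  abel

theorem IsHamiltonianSolution.hasDerivWithinAt_of_eqOn_mul_inv {X Y P : ℝ → Matrix n n ℝ}
    {s : Set ℝ} (h : IsHamiltonianSolution A B C X Y) (hunit : ∀ t ∈ s, IsUnit (X t))
    (hP : EqOn P (fun t => Y t * (X t)⁻¹) s) :
    ∀ t ∈ s, HasDerivWithinAt P (riccatiField A B C (P t)) s t := fun t ht => by
  rw [hP ht]
  exact (h.hasDerivAt_mul_inv (hunit t ht)).hasDerivWithinAt.congr hP (hP ht)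

end Riccati

section Verification

variable {n p m : ℕ} {A : Matrix (Fin n) (Fin n) ℝ} {B : Matrix (Fin n) (Fin p) ℝ}
  {C : Matrix (Fin m) (Fin n) ℝ} {P : ℝ → Matrix (Fin n) (Fin n) ℝ} {τ T : ℝ}
  {ξ : EuclideanSpace ℝ (Fin n)} {u : ℝ → EuclideanSpace ℝ (Fin p)}
  {x : ℝ → EuclideanSpace ℝ (Fin n)}

open scoped Matrix.Norms.Operator

theorem isLQTrajectory_of_hasDerivAt
    (hx : ∀ t ∈ Icc τ T, HasDerivAt x (toEuclideanLin A (x t) + toEuclideanLin B (u t)) t)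
    (hu : ContinuousOn u (Icc τ T)) : IsLQTrajectory A B τ T (x τ) u x := by
  have hxc : ContinuousOn x (Icc τ T) := fun t ht => (hx t ht).continuousAt.continuousWithinAt
  have hx'c := (continuousOn_toEuclideanLin_apply (M := fun _ => A) continuousOn_const hxc).add
    (continuousOn_toEuclideanLin_apply (M := fun _ => B) continuousOn_const hu)
  refine ⟨hxc, fun t ht => ?_⟩
  have hsub : uIcc τ t ⊆ Icc τ T := uIcc_of_le ht.1 ▸ Icc_subset_Icc_right ht.2
  rw [intervalIntegral.integral_eq_sub_of_hasDerivAt (fun s hs => hx s (hsub hs))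
    (hx'c.mono hsub).intervalIntegrable, add_sub_cancel]

namespace IsLQTrajectory

theorem apply_left (hx : IsLQTrajectory A B τ T ξ u x) (hτ : τ ≤ T) : x τ = ξ := by
  simpa only [intervalIntegral.integral_same, add_zero] using hx.2 τ (left_mem_Icc.2 hτ)

theorem intervalIntegrable_deriv (hx : IsLQTrajectory A B τ T ξ u x) (hτ : τ ≤ T)
    (hu : IntervalIntegrable u volume τ T) :
    IntervalIntegrable (fun s => toEuclideanLin A (x s) + toEuclideanLin B (u s)) volume τ T := by
  have hA := continuousOn_toEuclideanLin_apply (M := fun _ => A) continuousOn_const hx.1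
  rw [← uIcc_of_le hτ] at hA
  let L := LinearMap.toContinuousLinearMap (toEuclideanLin B)
  exact hA.intervalIntegrable.add ⟨L.integrable_comp hu.1, L.integrable_comp hu.2⟩

theorem eq_add_integral (hx : IsLQTrajectory A B τ T ξ u x) (hτ : τ ≤ T) :
    ∀ t ∈ Icc τ T,
      x t = x τ + ∫ s in τ..t, (toEuclideanLin A (x s) + toEuclideanLin B (u s)) := by
  rw [hx.apply_left hτ]
  exact hx.2

theorem absolutelyContinuousOnInterval (hx : IsLQTrajectory A B τ T ξ u x) (hτ : τ ≤ T)
    (hu : IntervalIntegrable u volume τ T) : AbsolutelyContinuousOnInterval x τ T :=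
  absolutelyContinuousOnInterval_of_eqOn_primitive (hx.intervalIntegrable_deriv hτ hu)
    (uIcc_of_le hτ ▸ hx.eq_add_integral hτ)

theorem ae_hasDerivAt (hx : IsLQTrajectory A B τ T ξ u x) (hτ : τ ≤ T)
    (hu : IntervalIntegrable u volume τ T) :
    ∀ᵐ t, t ∈ Ioo τ T → HasDerivAt x (toEuclideanLin A (x t) + toEuclideanLin B (u t)) t :=
  ae_hasDerivAt_of_eqOn_primitive hτ (hx.intervalIntegrable_deriv hτ hu) (hx.eq_add_integral hτ)

theorem ae_hasDerivAt_inner (hx : IsLQTrajectory A B τ T ξ u x) (hτ : τ ≤ T)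
    (hu : IntervalIntegrable u volume τ T) (hsymm : ∀ t ∈ Icc τ T, (P t).IsSymm)
    (hP : ∀ t ∈ Icc τ T, HasDerivWithinAt P (riccatiField A B C (P t)) (Icc τ T) t) :
    ∀ᵐ t, t ∈ Ioo τ T → HasDerivAt (fun s => inner ℝ (toEuclideanLin (P s) (x s)) (x s))
      (‖u t + toEuclideanLin Bᵀ (toEuclideanLin (P t) (x t))‖ ^ 2 -
        (‖toEuclideanLin C (x t)‖ ^ 2 + ‖u t‖ ^ 2)) t := by
  filter_upwards [hx.ae_hasDerivAt hτ hu] with t hxt hmem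
  have ht := Ioo_subset_Icc_self hmem
  have hPt := (hP t ht).hasDerivAt (Icc_mem_nhds hmem.1 hmem.2)
  refine ((hasDerivAt_toEuclideanLin_apply hPt (hxt hmem)).inner ℝ (hxt hmem)).congr_deriv ?_
  have hPx' := isSymmetric_toEuclideanLin (hsymm t ht)
    (toEuclideanLin A (x t) + toEuclideanLin B (u t)) (x t)
  rw [← inner_riccatiField_add (hsymm t ht), inner_add_left, hPx',
    real_inner_comm (toEuclideanLin (P t) (x t))]
  ring

theorem lqCost_eq (hx : IsLQTrajectory A B τ T ξ u x) (hτ : τ ≤ T)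
    (hu : MemLp u 2 (volume.restrict (Ioo τ T))) (hsymm : ∀ t ∈ Icc τ T, (P t).IsSymm)
    (hP : ∀ t ∈ Icc τ T, HasDerivWithinAt P (riccatiField A B C (P t)) (Icc τ T) t) :
    lqCost C (P T) τ T x u = inner ℝ (toEuclideanLin (P τ) ξ) ξ +
      ∫ s in τ..T, ‖u s + toEuclideanLin Bᵀ (toEuclideanLin (P s) (x s))‖ ^ 2 := by
  have hui : IntervalIntegrable u volume τ T :=
    intervalIntegrable_of_memLp_restrict_Ioo hτ one_le_two hu
  have hPc : ContinuousOn P (Icc τ T) := fun t ht => (hP t ht).continuousWithinAt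
  have hPac := absolutelyContinuousOnInterval_of_hasDerivWithinAt hτ hP
    (continuous_riccatiField.comp_continuousOn hPc)
  have hFTC := integral_eq_sub_of_absolutelyContinuousOnInterval hτ
    (absolutelyContinuousOnInterval_inner_toEuclideanLin hPac
      (hx.absolutelyContinuousOnInterval hτ hui)) (hx.ae_hasDerivAt_inner hτ hui hsymm hP)
  have hK := continuousOn_toEuclideanLin_apply (M := fun _ => Bᵀ) continuousOn_const
    (continuousOn_toEuclideanLin_apply hPc hx.1)
  have hC := continuousOn_toEuclideanLin_apply (M := fun _ => C) continuousOn_const hx.1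
  have hcost : IntervalIntegrable (fun s => ‖toEuclideanLin C (x s)‖ ^ 2 + ‖u s‖ ^ 2) volume τ T :=
    (intervalIntegrable_norm_sq hτ (memLp_restrict_Ioo_of_continuousOn hC 2)).add
      (intervalIntegrable_norm_sq hτ hu)
  have hsquare : IntervalIntegrable
      (fun s => ‖u s + toEuclideanLin Bᵀ (toEuclideanLin (P s) (x s))‖ ^ 2) volume τ T :=
    intervalIntegrable_norm_sq hτ (hu.add (memLp_restrict_Ioo_of_continuousOn hK 2))
  rw [intervalIntegral.integral_sub hsquare hcost, hx.apply_left hτ] at hFTC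
  rw [lqCost]
  linarith

end IsLQTrajectory

theorem isLeast_lqCosts (hτ : τ ≤ T) (hsymm : ∀ t ∈ Icc τ T, (P t).IsSymm)
    (hP : ∀ t ∈ Icc τ T, HasDerivWithinAt P (riccatiField A B C (P t)) (Icc τ T) t)
    (hx : ∀ t ∈ Icc τ T, HasDerivAt x (toEuclideanLin A (x t) -
      toEuclideanLin B (toEuclideanLin Bᵀ (toEuclideanLin (P t) (x t)))) t) :
    IsLeast (lqCosts A B C (P T) τ T (x τ)) (inner ℝ (toEuclideanLin (P τ) (x τ)) (x τ)) := by
  let v : ℝ → EuclideanSpace ℝ (Fin p) := fun t =>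
    -toEuclideanLin Bᵀ (toEuclideanLin (P t) (x t))
  have hv : ContinuousOn v (Icc τ T) :=
    (continuousOn_toEuclideanLin_apply (M := fun _ => Bᵀ) continuousOn_const
      (continuousOn_toEuclideanLin_apply (fun t ht => (hP t ht).continuousWithinAt)
        fun t ht => (hx t ht).continuousAt.continuousWithinAt)).neg
  have htraj : IsLQTrajectory A B τ T (x τ) v x :=
    isLQTrajectory_of_hasDerivAt (fun t ht => by
      simpa only [v, map_neg, ← sub_eq_add_neg] using hx t ht) hv
  have hvL : MemLp v 2 (volume.restrict (Ioo τ T)) := memLp_restrict_Ioo_of_continuousOn hv 2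
  constructor
  · refine ⟨v, x, hvL, htraj, ?_⟩
    simp [htraj.lqCost_eq hτ hvL hsymm hP, v]
  · rintro _ ⟨u, y, hu, hy, rfl⟩
    rw [hy.lqCost_eq hτ hu hsymm hP, le_add_iff_nonneg_right]
    exact intervalIntegral.integral_nonneg hτ fun t _ => sq_nonneg _

end Verification

section ValueMatrix

variable {n p m : ℕ} {A : Matrix (Fin n) (Fin n) ℝ} {B : Matrix (Fin n) (Fin p) ℝ}
  {C : Matrix (Fin m) (Fin n) ℝ} {P₀ : Matrix (Fin n) (Fin n) ℝ} {τ T : ℝ}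

theorem IsLQValueMatrix.unique {Q R : Matrix (Fin n) (Fin n) ℝ}
    (hQ : IsLQValueMatrix A B C P₀ τ T Q) (hR : IsLQValueMatrix A B C P₀ τ T R) : Q = R :=
  eq_of_isSymm_of_inner_toEuclideanLin_eq hQ.1 hR.1 fun v => (hQ.2 v).unique (hR.2 v)

open scoped Matrix.Norms.Operator in
theorem IsHamiltonianSolution.isLQValueMatrix {X Y : ℝ → Matrix (Fin n) (Fin n) ℝ}
    (h : IsHamiltonianSolution A B C X Y) (hX : X T = 1) (hY : (Y T).PosSemidef) (hτ : τ ≤ T) :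
    IsLQValueMatrix A B C (Y T) τ T (Y τ * (X τ)⁻¹) := by
  have hunit : ∀ t ≤ T, IsUnit (X t) := fun t ht => h.isUnit_state ht hX hY
  have hinv : ∀ t ≤ T, (X t)⁻¹ * X t = 1 := fun t ht =>
    Matrix.nonsing_inv_mul _ ((Matrix.isUnit_iff_isUnit_det _).1 (hunit t ht))
  have hYT : ((X T)ᵀ * Y T).IsSymm := by
    simpa [hX, Matrix.IsSymm] using hY.isHermitian.eq
  have hsymm : ∀ t ≤ T, (Y t * (X t)⁻¹).IsSymm := fun t ht =>
    isSymm_mul_inv (hunit t ht) (h.isSymm_transpose_mul hYT t)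
  refine ⟨hsymm τ hτ, fun ξ => ?_⟩
  have hleast := isLeast_lqCosts (x := fun t => toEuclideanLin (X t) (toEuclideanLin (X τ)⁻¹ ξ))
    (P := fun t => Y t * (X t)⁻¹) hτ (fun t ht => hsymm t ht.2)
    (fun t ht => (h.hasDerivAt_mul_inv (hunit t ht.2)).hasDerivWithinAt) fun t ht => by
      rw [← toEuclideanLin_mul_apply (Y t * _) (X t), Matrix.mul_assoc, hinv t ht.2,
        Matrix.mul_one]
      exact h.hasDerivAt_state_apply _ t
  simpa only [← toEuclideanLin_mul_apply, Matrix.mul_assoc, hX,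
    mul_eq_one_comm.1 (hinv τ hτ), Matrix.mul_one, inv_one, Matrix.toLpLin_one,
    LinearMap.id_apply] using hleast.isGLB

end ValueMatrix

theorem corollary9p1 {n p m : ℕ} (A : Matrix (Fin n) (Fin n) ℝ) (B : Matrix (Fin n) (Fin p) ℝ)
    (C : Matrix (Fin m) (Fin n) ℝ) (P₀ : Matrix (Fin n) (Fin n) ℝ) (hP₀ : P₀.PosSemidef)
    (T : ℝ) (hT : 0 < T) :
    (∀ τ ∈ Icc 0 T, ∃! Q : Matrix (Fin n) (Fin n) ℝ, IsLQValueMatrix A B C P₀ τ T Q) ∧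
    ∀ P : ℝ → Matrix (Fin n) (Fin n) ℝ,
      (∀ τ ∈ Icc 0 T, IsLQValueMatrix A B C P₀ τ T (P τ)) →
        DifferentiableOn ℝ P (Icc 0 T) ∧
        (∀ t ∈ Icc 0 T,
          derivWithin P (Icc 0 T) t + P t * A + A.transpose * P t
            - P t * B * B.transpose * P t + C.transpose * C = 0) ∧
        P T = P₀ := by
  obtain ⟨X, Y, h, hX, hY⟩ := exists_isHamiltonianSolution A B C T 1 P₀
  subst hY
  have hval : ∀ τ ∈ Icc 0 T, IsLQValueMatrix A B C (Y T) τ T (Y τ * (X τ)⁻¹) := fun τ hτ =>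
    h.isLQValueMatrix hX hP₀ hτ.2
  refine ⟨fun τ hτ => ⟨_, hval τ hτ, fun R hR => hR.unique (hval τ hτ)⟩, fun P hP => ?_⟩
  have hPeq : EqOn P (fun t => Y t * (X t)⁻¹) (Icc 0 T) := fun t ht =>
    (hP t ht).unique (hval t ht)
  have hderiv := h.hasDerivWithinAt_of_eqOn_mul_inv
    (fun t ht => h.isUnit_state ht.2 hX hP₀) hPeq
  refine ⟨differentiableOn_of_hasDerivWithinAt_riccatiField hderiv, fun t ht => ?_, ?_⟩
  · exact derivWithin_add_eq_zero_of_hasDerivWithinAt_riccatiField (uniqueDiffOn_Icc hT t ht)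
      (hderiv t ht)
  · simpa only [hX, inv_one, mul_one] using hPeq (right_mem_Icc.2 hT.le)
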